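/- Let $X$ be a real normed space. A bounded linear operator $T:X\to X$ is called \emph{numerically positive} if for every $x\in X$ there exists $x^*\in X^*$ with $\|x^*\|^2=\|x\|^2=x^*(x)$ and $x^*(Tx)\ge 0$. An element $u\in X$ is called a \emph{Flinn element} if there exists a numerically positive projection (bounded, linear, idempotent) $P:X\to X$ whose range is $\operatorname{span}\{u\}$; for $u\neq 0$ this means that there is $f\in X^*$ with $f(u)=1$ such that $x\mapsto f(x)u$ is numerically positive, and $u=0$ is always a Flinn element (take $P=0$). Let $\mathcal F(X)$ denote the set of all Flinn elements of $X$. \textbf{Theorem.} Suppose that $X$ is a real Banach space with $\dim X\ge 3$ (possibly infinite-dimensional) and $\mathcal F(X)=X$. Then $X$ is isometric to a Hilbert space, that is, there is a surjective linear isometry from $X$ onto a real Hilbert space. -/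

import Mathlib

universe u

/-- A bounded operator `T` on a real normed space is numerically positive if for every `x` there is
a bounded functional `xs` with `‖xs‖² = ‖x‖² = xs x` and `xs (T x) ≥ 0`. -/
def IsNumericallyPositive {X : Type*} [NormedAddCommGroup X] [NormedSpace ℝ X]
    (T : X →L[ℝ] X) : Prop :=
  ∀ x : X, ∃ xs : StrongDual ℝ X, ‖xs‖ ^ 2 = ‖x‖ ^ 2 ∧ xs x = ‖x‖ ^ 2 ∧ 0 ≤ xs (T x)

/-- `u` is a Flinn element if some numerically positive (bounded, linear, idempotent) projection
has range exactly `span {u}`. For `u ≠ 0` these projections are the maps `x ↦ f x • u` with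
`f u = 1`; for `u = 0` the zero operator qualifies, so `0` is a Flinn element. -/
def IsFlinnElement {X : Type*} [NormedAddCommGroup X] [NormedSpace ℝ X] (u : X) : Prop :=
  ∃ P : X →L[ℝ] X, (∀ x, P (P x) = P x) ∧ Set.range P = (Submodule.span ℝ {u} : Set X) ∧
    IsNumericallyPositive P

/-- The set `ℱ(X)` of all Flinn elements of `X`. -/
def flinnElements (X : Type*) [NormedAddCommGroup X] [NormedSpace ℝ X] : Set X :=
  {u | IsFlinnElement u}

/-!
A numerically positive projection `P` satisfies `‖x - P x‖ ≤ ‖x‖`, because the norm does not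
decrease along the segment from `x - P x` to `x`. So in a space all of whose elements are Flinn
elements every line is the kernel of a norm-one projection onto a hyperplane
(`HasContractiveHyperplanes`). This property passes to subspaces. Since the parallelogram law
involves only two vectors, it is enough to prove it for a three-dimensional `E` with this property.

Suppose that the functional `x` exposes the unit vector `e` of the unit ball of `E`. For
`u ∈ ker x`, the contractive projection along `u` fixes `e`, so it maps every section
`K = {z ∈ ker x | ‖e + z‖ ≤ c}` of a ball into itself. In the plane `ker x` this says that, for each
direction `u`, the two supporting lines of `K` parallel to `u` touch `K` on one common line through
`0`. Hence along a segment `ξ t` of functionals the support functions of `K` and of `-K` have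
proportional subgradients, their ratio is constant (`mul_le_mul_of_common_slope`), and `K = -K`
(`neg_mem_of_invariant_projections`). Thus the linear reflection that maps `e` to `-e` and fixes
`ker x` is an isometry. Exposing functionals are dense, so by compactness every unit functional `x`
has such a vector `e` (`exists_reflection_of_hasContractiveHyperplanes`).

Dually, for each unit vector `x` of `D = E*` there is a functional `g x` whose reflection
`y ↦ y - 2 g x(y) x` is isometric. The functional `g x` is unique, hence depends continuously
on `x` and is equivariant under these reflections. The intermediate value theorem yields
a reflection exchanging two given unit vectors `x`, `y` up to sign, and equivariance then gives
`g x y = g y x`. Therefore `g` extends to a symmetric bilinear form whose quadratic form is the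
square of the norm (`parallelogram_of_isNormReflection`). So `D` is Euclidean, and so is `E`, which
embeds in the dual of `D`.
-/

open Filter Topology

/-! ### Two functions with the same logarithmic subgradient -/

/-- Two positive functions on the line with a common logarithmic subgradient `m` are proportional;
this is one of the two inequalities. With step `d = 1 / n`, the ratio `k / h` grows from `t` to
`t + d` by a factor at most `((1 - d * m (t + d)) * (1 + d * m t))⁻¹`. The linear terms telescope
over `[0, 1]`, and the accumulated error is of order `d`. -/
theorem mul_le_mul_of_common_slope {h k m : ℝ → ℝ} {M : ℝ}
    (hh : ∀ t, 0 < h t) (hk : ∀ t, 0 < k t) (hm : ∀ t ∈ Set.Icc (0 : ℝ) 1, |m t| ≤ M)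
    (hhm : ∀ s ∈ Set.Icc (0 : ℝ) 1, ∀ t, h s * (1 + (t - s) * m s) ≤ h t)
    (hkm : ∀ s ∈ Set.Icc (0 : ℝ) 1, ∀ t, k s * (1 + (t - s) * m s) ≤ k t) :
    k 1 * h 0 ≤ k 0 * h 1 := by
  have hM0 : 0 ≤ M := (abs_nonneg _).trans (hm 0 (by simp))
  have key : ∀ᶠ n : ℕ in atTop, k 1 * h 0 * ((1 - M * (1 / (n : ℝ))) * (1 - M ^ 2 * (1 / (n : ℝ))))
      ≤ k 0 * h 1 * (1 + M * (1 / (n : ℝ))) := by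
    obtain ⟨n₀, hn₀⟩ := exists_nat_gt M
    filter_upwards [eventually_gt_atTop n₀] with n hn
    have hn1 : M < n := hn₀.trans (by exact_mod_cast hn)
    have hnpos : (0 : ℝ) < n := hM0.trans_lt hn1
    obtain ⟨d, hd⟩ : ∃ d : ℝ, d = 1 / n := ⟨_, rfl⟩
    have hdn : d * n = 1 := by rw [hd]; field_simp
    have hd0 : 0 < d := by rw [hd]; positivity
    have hMd : M * d < 1 := by rw [hd, mul_one_div, div_lt_one hnpos]; exact hn1
    have hmem : ∀ j : ℕ, j ≤ n → d * j ∈ Set.Icc (0 : ℝ) 1 := fun j hj => by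
      refine ⟨by positivity, ?_⟩
      rw [← hdn]
      have : (j : ℝ) ≤ n := by exact_mod_cast hj
      gcongr
    have hb : ∀ j : ℕ, j ≤ n → |d * m (d * j)| ≤ M * d := fun j hj => by
      rw [abs_mul, abs_of_pos hd0, mul_comm]
      exact mul_le_mul_of_nonneg_right (hm _ (hmem j hj)) hd0.le
    have hq : 0 ≤ 1 - (M * d) ^ 2 := by nlinarith [mul_nonneg hM0 hd0.le]
    have ind : ∀ j : ℕ, j ≤ n → k (d * j) * h 0 * (1 - d * m (d * j)) * (1 - (M * d) ^ 2) ^ j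
        ≤ k 0 * h (d * j) * (1 + M * d) := by
      intro j
      induction j with
      | zero =>
        intro _
        have := (abs_le.1 (hb 0 (Nat.zero_le _))).1
        have hp := mul_pos (hk 0) (hh 0)
        simp only [Nat.cast_zero, mul_zero, pow_zero, mul_one] at this ⊢
        exact mul_le_mul_of_nonneg_left (by linarith) hp.le
      | succ j ih =>
        intro hj
        have ih := ih (by omega)
        have h1 := hhm _ (hmem j (by omega)) (d * (j + 1 : ℕ))
        have h2 := hkm _ (hmem (j + 1) hj) (d * j)
        have hb1 := abs_le.1 (hb j (by omega))
        obtain ⟨a, ha⟩ : ∃ a, a = d * m (d * j) := ⟨_, rfl⟩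
        obtain ⟨b, hb'⟩ : ∃ b, b = d * m (d * (j + 1 : ℕ)) := ⟨_, rfl⟩
        have e1 : 1 + (d * (j + 1 : ℕ) - d * j) * m (d * j) = 1 + a := by rw [ha]; push_cast; ring
        have e2 : 1 + (d * j - d * (j + 1 : ℕ)) * m (d * (j + 1 : ℕ)) = 1 - b := by
          rw [hb']; push_cast; ring
        rw [e1] at h1
        rw [e2] at h2
        rw [← ha] at hb1 ih
        rw [← hb']
        have ha1 : 0 ≤ 1 + a := by linarith
        have hsq : a ^ 2 ≤ (M * d) ^ 2 := sq_le_sq' hb1.1 hb1.2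
        have hQ := pow_nonneg hq j
        have hQ1 := pow_nonneg hq (j + 1)
        calc k (d * (j + 1 : ℕ)) * h 0 * (1 - b) * (1 - (M * d) ^ 2) ^ (j + 1)
            = k (d * (j + 1 : ℕ)) * (1 - b) * (h 0 * (1 - (M * d) ^ 2) ^ (j + 1)) := by ring
          _ ≤ k (d * j) * (h 0 * (1 - (M * d) ^ 2) ^ (j + 1)) :=
              mul_le_mul_of_nonneg_right h2 (mul_nonneg (hh 0).le hQ1)
          _ = k (d * j) * h 0 * (1 - (M * d) ^ 2) ^ j * (1 - (M * d) ^ 2) := by ring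
          _ ≤ k (d * j) * h 0 * (1 - (M * d) ^ 2) ^ j * ((1 - a) * (1 + a)) :=
              mul_le_mul_of_nonneg_left (by nlinarith)
                (mul_nonneg (mul_nonneg (hk _).le (hh 0).le) hQ)
          _ = k (d * j) * h 0 * (1 - a) * (1 - (M * d) ^ 2) ^ j * (1 + a) := by ring
          _ ≤ k 0 * h (d * j) * (1 + M * d) * (1 + a) := mul_le_mul_of_nonneg_right ih ha1
          _ = h (d * j) * (1 + a) * (k 0 * (1 + M * d)) := by ring
          _ ≤ h (d * (j + 1 : ℕ)) * (k 0 * (1 + M * d)) :=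
              mul_le_mul_of_nonneg_right h1 (mul_nonneg (hk 0).le (by positivity))
          _ = k 0 * h (d * (j + 1 : ℕ)) * (1 + M * d) := by ring
    have hfin := ind n le_rfl
    rw [hdn] at hfin
    have hbn := abs_le.1 (hb n le_rfl)
    rw [hdn] at hbn
    have hbern := one_add_mul_le_pow (a := -(M * d) ^ 2) (by nlinarith) n
    have e3 : 1 + (n : ℝ) * -(M * d) ^ 2 = 1 - M ^ 2 * d := by
      linear_combination (-M ^ 2 * d) * hdn
    rw [e3, ← sub_eq_add_neg] at hbern
    have hp := mul_pos (hk 1) (hh 0)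
    rw [← hd]
    refine le_trans ?_ hfin
    rw [mul_assoc (k 1 * h 0)]
    refine mul_le_mul_of_nonneg_left ?_ hp.le
    calc (1 - M * d) * (1 - M ^ 2 * d) ≤ (1 - M * d) * (1 - (M * d) ^ 2) ^ n :=
          mul_le_mul_of_nonneg_left hbern (by linarith)
      _ ≤ _ := mul_le_mul_of_nonneg_right (by linarith) (pow_nonneg hq n)
  have lim : Tendsto (fun n : ℕ => 1 / (n : ℝ)) atTop (𝓝 0) := tendsto_one_div_atTop_nhds_zero_nat
  have l1 : Tendsto (fun n : ℕ => k 1 * h 0 * ((1 - M * (1 / (n : ℝ))) * (1 - M ^ 2 * (1 / (n : ℝ)))))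
      atTop (𝓝 (k 1 * h 0 * ((1 - M * 0) * (1 - M ^ 2 * 0)))) :=
    (((lim.const_mul M).const_sub 1).mul ((lim.const_mul (M ^ 2)).const_sub 1)).const_mul _
  have l2 : Tendsto (fun n : ℕ => k 0 * h 1 * (1 + M * (1 / (n : ℝ)))) atTop
      (𝓝 (k 0 * h 1 * (1 + M * 0))) := ((lim.const_mul M).const_add 1).const_mul _
  simpa using le_of_tendsto_of_tendsto l1 l2 key

/-! ### Contractive projections from Flinn elements -/

section Contractive
variable {E : Type*} [NormedAddCommGroup E] [NormedSpace ℝ E]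

/-- The complementary projection of a numerically positive projection is a contraction. -/
theorem IsNumericallyPositive.norm_sub_le {P : E →L[ℝ] E} (hP : IsNumericallyPositive P)
    (hidem : ∀ x, P (P x) = P x) (x : E) : ‖x - P x‖ ≤ ‖x‖ := by
  -- Numerical positivity at `x - P x + s • P x` gives a norming functional that is nonnegative
  -- on `P x`, but only for `s > 0`; the value `s = 0` is reached in the limit.
  have hseg : ∀ s ∈ Set.Ioc (0 : ℝ) 1, ‖x - P x + s • P x‖ ≤ ‖x‖ := by
    intro s hs
    set w := x - P x + s • P x with hw
    obtain ⟨g, hg1, hg2, hg3⟩ := hP w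
    have hPw : P w = s • P x := by simp [hw, hidem]
    rw [hPw, map_smul, smul_eq_mul] at hg3
    have hpos : 0 ≤ g (P x) := nonneg_of_mul_nonneg_right hg3 hs.1
    have hgn : ‖g‖ = ‖w‖ := by
      rwa [sq_eq_sq₀ (norm_nonneg _) (norm_nonneg _)] at hg1
    have hx : x = w + (1 - s) • P x := by rw [hw]; module
    have h1 : ‖w‖ ^ 2 ≤ g x := by
      rw [hx, map_add, hg2, map_smul, smul_eq_mul]
      have := mul_nonneg (sub_nonneg.2 hs.2) hpos
      linarith
    have h2 : g x ≤ ‖w‖ * ‖x‖ := by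
      rw [← hgn]; exact (le_abs_self _).trans (g.le_opNorm x)
    rcases (norm_nonneg w).eq_or_lt with h0 | h0
    · rw [← h0]; exact norm_nonneg _
    · exact le_of_mul_le_mul_left (by linarith [sq ‖w‖]) h0
  have hlim : Tendsto (fun s : ℝ => ‖x - P x + s • P x‖) (𝓝[>] 0) (𝓝 ‖x - P x + (0 : ℝ) • P x‖) :=
    ((by fun_prop : Continuous fun s : ℝ => ‖x - P x + s • P x‖).tendsto 0).mono_left
      nhdsWithin_le_nhds
  rw [zero_smul, add_zero] at hlim
  refine le_of_tendsto hlim ?_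
  filter_upwards [Ioc_mem_nhdsGT (zero_lt_one' ℝ)] with s hs using hseg s hs

/-- Every line is the kernel of a contractive projection onto a hyperplane. -/
def HasContractiveHyperplanes (E : Type*) [NormedAddCommGroup E] [NormedSpace ℝ E] : Prop :=
  ∀ u : E, u ≠ 0 → ∃ f : StrongDual ℝ E, f u = 1 ∧ ∀ x, ‖x - f x • u‖ ≤ ‖x‖

theorem hasContractiveHyperplanes_of_flinnElements_eq_univ (hF : flinnElements E = Set.univ) :
    HasContractiveHyperplanes E := by
  intro u hu
  obtain ⟨P, hidem, hrange, hP⟩ : IsFlinnElement u := by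
    have : u ∈ flinnElements E := hF ▸ Set.mem_univ u
    exact this
  obtain ⟨g, hg⟩ := SeparatingDual.exists_eq_one (R := ℝ) hu
  have hPx : ∀ x, P x = g (P x) • u := by
    intro x
    have : P x ∈ (Submodule.span ℝ {u} : Set E) := hrange ▸ Set.mem_range_self x
    obtain ⟨a, ha⟩ := Submodule.mem_span_singleton.1 this
    rw [← ha]; simp [hg]
  have hPu : P u = u := by
    obtain ⟨z, hz⟩ : u ∈ Set.range P := hrange ▸ Submodule.mem_span_singleton_self u
    rw [← hz, hidem]
  refine ⟨g.comp P, by simp [hPu, hg], fun x => ?_⟩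
  have := hP.norm_sub_le hidem x
  rwa [hPx x] at this

theorem HasContractiveHyperplanes.submodule (hE : HasContractiveHyperplanes E)
    (Y : Submodule ℝ E) : HasContractiveHyperplanes Y := by
  intro u hu
  obtain ⟨f, hf, hc⟩ := hE u (by simpa using hu)
  exact ⟨f.comp Y.subtypeL, hf, fun x => hc x⟩

end Contractive

/-! ### Symmetry of planar convex bodies invariant under projections in all directions -/

section Planar
variable {N : Type*} [NormedAddCommGroup N] [NormedSpace ℝ N]

/-- If for every direction `u` some projection along `u` maps the planar convex body `K` into
itself, then `K` is symmetric about the origin. -/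
theorem neg_mem_of_invariant_projections [FiniteDimensional ℝ N] (hdim : Module.finrank ℝ N = 2)
    {K : Set N} (hKc : IsCompact K) (hKconv : Convex ℝ K) (hK0 : K ∈ 𝓝 (0 : N))
    (hproj : ∀ u : N, u ≠ 0 → ∃ f : StrongDual ℝ N, f u = 1 ∧ ∀ y ∈ K, y - f y • u ∈ K)
    {y : N} (hy : y ∈ K) : -y ∈ K := by
  have hKne : K.Nonempty := ⟨y, hy⟩
  -- `h` is the support function of `K`.
  have hsup : ∀ ξ : StrongDual ℝ N, ∃ h : ℝ, (∀ z ∈ K, ξ z ≤ h) ∧ ∃ z ∈ K, ξ z = h := fun ξ => by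
    obtain ⟨z, hz, hmax⟩ := hKc.exists_isMaxOn hKne ξ.continuous.continuousOn
    exact ⟨ξ z, fun w hw => hmax hw, z, hz, rfl⟩
  choose h hle hatt using hsup
  have hsmall : ∀ z : N, ∃ c : ℝ, 0 < c ∧ c • z ∈ K := fun z => by
    have : Tendsto (fun c : ℝ => c • z) (𝓝[>] 0) (𝓝 ((0 : ℝ) • z)) :=
      ((by fun_prop : Continuous fun c : ℝ => c • z).tendsto 0).mono_left nhdsWithin_le_nhds
    rw [zero_smul] at this
    obtain ⟨c, hc, hc0⟩ := ((this.eventually hK0).and self_mem_nhdsWithin).exists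
    exact ⟨c, hc0, hc⟩
  have hpos : ∀ ξ : StrongDual ℝ N, ξ ≠ 0 → 0 < h ξ := fun ξ hξ => by
    obtain ⟨z, hz⟩ : ∃ z, ξ z ≠ 0 := by
      by_contra! hcon
      exact hξ (ContinuousLinearMap.ext hcon)
    obtain ⟨c, hc, hcK⟩ := hsmall (ξ z • z)
    have h1 := hle ξ _ hcK
    simp only [map_smul, smul_eq_mul] at h1
    exact (mul_pos hc (mul_self_pos.2 hz)).trans_le h1
  -- The two supporting lines of `K` parallel to `ker ξ` touch `K` on a common line through `0`.
  have htouch : ∀ ξ : StrongDual ℝ N, ξ ≠ 0 →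
      ∃ v, ξ v = 1 ∧ h ξ • v ∈ K ∧ -(h (-ξ) • v) ∈ K := fun ξ hξ => by
    obtain ⟨z₀, hz₀⟩ : ∃ z, ξ z = 1 := by
      obtain ⟨z, hz⟩ : ∃ z, ξ z ≠ 0 := by
        by_contra! hcon
        exact hξ (ContinuousLinearMap.ext hcon)
      exact ⟨(ξ z)⁻¹ • z, by simp [hz]⟩
    have hker : Module.finrank ℝ (LinearMap.ker (ξ : N →ₗ[ℝ] ℝ)) = 1 := by
      have h1 := LinearMap.finrank_range_add_finrank_ker (ξ : N →ₗ[ℝ] ℝ)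
      have h2 : LinearMap.range (ξ : N →ₗ[ℝ] ℝ) = ⊤ :=
        LinearMap.range_eq_top.2 fun a => ⟨a • z₀, by simp [hz₀]⟩
      rw [h2, finrank_top, Module.finrank_self, hdim] at h1
      omega
    obtain ⟨⟨u, hu⟩, hu0, hspan⟩ := finrank_eq_one_iff'.1 hker
    have hu0 : u ≠ 0 := by simpa using hu0
    have hu' : ξ u = 0 := hu
    obtain ⟨f, hfu, hfK⟩ := hproj u hu0
    have hform : ∀ z, z - f z • u = ξ z • (z₀ - f z₀ • u) := fun z => by
      have hz : z - ξ z • z₀ ∈ LinearMap.ker (ξ : N →ₗ[ℝ] ℝ) := by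
        simp [hz₀]
      obtain ⟨c, hc⟩ := hspan ⟨_, hz⟩
      have hc : c • u = z - ξ z • z₀ := congrArg Subtype.val hc
      have hz2 : z = ξ z • z₀ + c • u := by rw [hc]; abel
      have hfz : f z = ξ z * f z₀ + c := by
        conv_lhs => rw [hz2]
        simp [hfu]
      rw [hfz]
      nth_rewrite 1 [hz2]
      module
    refine ⟨z₀ - f z₀ • u, by simp [hz₀, hu'], ?_, ?_⟩
    · obtain ⟨z, hz, hzh⟩ := hatt ξ
      rw [← hzh, ← hform]
      exact hfK z hz
    · obtain ⟨z, hz, hzh⟩ := hatt (-ξ)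
      have : -(h (-ξ) • (z₀ - f z₀ • u)) = ξ z • (z₀ - f z₀ • u) := by
        rw [← hzh, ← neg_smul]; simp
      rw [this, ← hform]
      exact hfK z hz
  choose! v hv1 hvK hvK' using htouch
  -- The ratio `h (-ξ) / h ξ` takes the same value at any two functionals equal to `1` at a
  -- common point.
  have hratio : ∀ ξ₀ ξ₁ : StrongDual ℝ N, (∃ z, ξ₀ z = 1 ∧ ξ₁ z = 1) →
      h (-ξ₁) * h ξ₀ = h (-ξ₀) * h ξ₁ := by
    intro ξ₀ ξ₁ ⟨z, hz₀, hz₁⟩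
    -- All `ξ t` take the value `1` at `z`; this keeps `h (ξ t)` away from zero.
    let ξ : ℝ → StrongDual ℝ N := fun t => ξ₀ + t • (ξ₁ - ξ₀)
    have hξz : ∀ t, ξ t z = 1 := fun t => by simp [ξ, hz₀, hz₁]
    have hξ0 : ∀ t, ξ t ≠ 0 := fun t h0 => by simpa [h0] using hξz t
    have hξ0' : ∀ t, -ξ t ≠ 0 := fun t => neg_ne_zero.2 (hξ0 t)
    have hξv : ∀ s t, ξ t (v (ξ s)) = 1 + (t - s) * (ξ₁ - ξ₀) (v (ξ s)) := fun s t => by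
      have : ξ t = ξ s + (t - s) • (ξ₁ - ξ₀) := by simp only [ξ]; module
      conv_lhs => rw [this]
      simp [hv1 _ (hξ0 s)]
    obtain ⟨c, hc0, hcK⟩ := hsmall z
    obtain ⟨R, hR⟩ := hKc.isBounded.exists_norm_le
    have hch : ∀ t, c ≤ h (ξ t) := fun t => by
      have := hle (ξ t) _ hcK
      simpa [hξz] using this
    have hm : ∀ t, |(ξ₁ - ξ₀) (v (ξ t))| ≤ ‖ξ₁ - ξ₀‖ * R / c := fun t => by
      have h1 : |(ξ₁ - ξ₀) (h (ξ t) • v (ξ t))| ≤ ‖ξ₁ - ξ₀‖ * R :=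
        ((ξ₁ - ξ₀).le_opNorm _).trans
          (mul_le_mul_of_nonneg_left (hR _ (hvK _ (hξ0 t))) (norm_nonneg _))
      rw [map_smul, smul_eq_mul, abs_mul, abs_of_pos (hpos _ (hξ0 t))] at h1
      rw [le_div_iff₀ hc0, mul_comm]
      exact (mul_le_mul_of_nonneg_right (hch t) (abs_nonneg _)).trans h1
    have hh : ∀ s t, h (ξ s) * (1 + (t - s) * (ξ₁ - ξ₀) (v (ξ s))) ≤ h (ξ t) := fun s t => by
      have := hle (ξ t) _ (hvK _ (hξ0 s))
      rwa [map_smul, smul_eq_mul, hξv] at this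
    have hk : ∀ s t, h (-ξ s) * (1 + (t - s) * (ξ₁ - ξ₀) (v (ξ s))) ≤ h (-ξ t) := fun s t => by
      have := hle (-ξ t) _ (hvK' _ (hξ0 s))
      rwa [map_neg, neg_apply, neg_neg, map_smul, smul_eq_mul, hξv] at this
    have e0 : ξ 0 = ξ₀ := by simp [ξ]
    have e1 : ξ 1 = ξ₁ := by simp [ξ]
    have r1 := mul_le_mul_of_common_slope (h := fun t => h (ξ t)) (k := fun t => h (-ξ t))
      (m := fun t => (ξ₁ - ξ₀) (v (ξ t))) (fun t => hpos _ (hξ0 t)) (fun t => hpos _ (hξ0' t))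
      (fun t _ => hm t) (fun s _ t => hh s t) (fun s _ t => hk s t)
    have r2 := mul_le_mul_of_common_slope (h := fun t => h (-ξ t)) (k := fun t => h (ξ t))
      (m := fun t => (ξ₁ - ξ₀) (v (ξ t))) (fun t => hpos _ (hξ0' t)) (fun t => hpos _ (hξ0 t))
      (fun t _ => hm t) (fun s _ t => hk s t) (fun s _ t => hh s t)
    simp only [e0, e1] at r1 r2
    linarith
  have hsymm : ∀ ξ : StrongDual ℝ N, ξ ≠ 0 → h (-ξ) = h ξ := fun ξ hξ => by
    obtain ⟨u, hu, hu0⟩ : ∃ u, ξ u = 0 ∧ u ≠ 0 := by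
      have h1 := LinearMap.finrank_range_add_finrank_ker (ξ : N →ₗ[ℝ] ℝ)
      have h2 := (LinearMap.range (ξ : N →ₗ[ℝ] ℝ)).finrank_le
      rw [Module.finrank_self] at h2
      have h3 : LinearMap.ker (ξ : N →ₗ[ℝ] ℝ) ≠ ⊥ := fun hb => by
        rw [hb, finrank_bot] at h1; omega
      obtain ⟨u, hu, hu0⟩ := Submodule.exists_mem_ne_zero_of_ne_bot h3
      exact ⟨u, hu, hu0⟩
    obtain ⟨η, hη⟩ := SeparatingDual.exists_eq_one (R := ℝ) hu0
    have hη0 : η ≠ 0 := fun h0 => by simp [h0] at hη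
    have hz : ξ (v ξ - η (v ξ) • u) = 1 ∧ η (v ξ - η (v ξ) • u) = 0 := by
      simp [hu, hη, hv1 ξ hξ]
    -- The ratio at `ξ` equals the ratio at `η`, hence also the ratio at `-ξ`, which is its inverse.
    have r1 := hratio ξ η ⟨(v ξ - η (v ξ) • u) + u, by rw [map_add, hz.1, hu, add_zero],
      by rw [map_add, hz.2, hη, zero_add]⟩
    have r2 := hratio (-ξ) η ⟨-(v ξ - η (v ξ) • u) + u,
      by rw [neg_apply, map_add, map_neg, hz.1, hu]; norm_num,
      by rw [map_add, map_neg, hz.2, hη]; norm_num⟩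
    rw [neg_neg] at r2
    have p1 := hpos ξ hξ
    have p2 := hpos (-ξ) (neg_ne_zero.2 hξ)
    have p3 := hpos η hη0
    have p4 := hpos (-η) (neg_ne_zero.2 hη0)
    have : (h (-ξ) - h ξ) * (h η + h (-η)) = 0 := by linear_combination r2 - r1
    rcases mul_eq_zero.1 this with h0 | h0
    · linarith
    · linarith
  by_contra hny
  obtain ⟨ξ, s, hs, hsy⟩ := geometric_hahn_banach_closed_point hKconv hKc.isClosed hny
  have hξ : ξ ≠ 0 := fun h0 => by
    have := hs y hy
    simp only [h0, zero_apply] at this hsy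
    linarith
  obtain ⟨z, hz, hzh⟩ := hatt ξ
  have h1 := hs z hz
  have h2 := hle (-ξ) y hy
  rw [hsymm ξ hξ, neg_apply] at h2
  rw [map_neg] at hsy
  linarith

end Planar

/-! ### Isometric reflections in three-dimensional spaces -/

section Exposed
variable {E : Type*} [NormedAddCommGroup E] [NormedSpace ℝ E]

/-- If `x` exposes the unit vector `e`, then each contractive projection along a vector
`u ∈ ker x` must fix `e`. -/
theorem apply_exposed_eq_zero {x f : StrongDual ℝ E} {e u : E} (he : ‖e‖ = 1)
    (hexp : ∀ b, ‖b‖ ≤ 1 → x e ≤ x b → b = e) (hxu : x u = 0) (hu : u ≠ 0)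
    (hf : ‖e - f e • u‖ ≤ ‖e‖) : f e = 0 := by
  have := hexp (e - f e • u) (hf.trans he.le) (by simp [hxu])
  simpa [hu] using this

/-- The section `{w ∈ ker x | ‖e + w‖ ≤ ‖e + z‖}` of a ball is symmetric, being invariant under
contractive projections in all directions of the plane `ker x`. -/
theorem norm_sub_le_norm_add_of_exposed [FiniteDimensional ℝ E]
    (hdim : Module.finrank ℝ E = 3) (hE : HasContractiveHyperplanes E)
    {x : StrongDual ℝ E} {e : E} (he : ‖e‖ = 1) (hxe : 0 < x e)
    (hexp : ∀ b, ‖b‖ ≤ 1 → x e ≤ x b → b = e) {z : E} (hz : x z = 0) :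
    ‖e - z‖ ≤ ‖e + z‖ := by
  have hker : Module.finrank ℝ (LinearMap.ker (x : E →ₗ[ℝ] ℝ)) = 2 := by
    have h1 := LinearMap.finrank_range_add_finrank_ker (x : E →ₗ[ℝ] ℝ)
    have h2 : LinearMap.range (x : E →ₗ[ℝ] ℝ) = ⊤ :=
      LinearMap.range_eq_top.2 fun a => ⟨(a / x e) • e, by simp [hxe.ne']⟩
    rw [h2, finrank_top, Module.finrank_self, hdim] at h1
    omega
  -- Only sections of balls of radius greater than one have interior points in `ker x`.
  rcases le_or_gt ‖e + z‖ 1 with hc | hc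
  · have := hexp (e + z) hc (by simp [hz])
    have hz0 : z = 0 := by simpa using this
    simp [hz0]
  let K : Set (LinearMap.ker (x : E →ₗ[ℝ] ℝ)) := {w | ‖e + w‖ ≤ ‖e + z‖}
  have hcont : Continuous fun w : LinearMap.ker (x : E →ₗ[ℝ] ℝ) => ‖e + w‖ := by fun_prop
  have hclosed : IsClosed K := isClosed_le hcont continuous_const
  have hK : K = ((↑) : LinearMap.ker (x : E →ₗ[ℝ] ℝ) → E) ⁻¹'
      ((fun w => e + w) ⁻¹' Metric.closedBall 0 ‖e + z‖) := by
    ext w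
    simp only [K, Set.mem_ofPred_eq, Set.mem_preimage, mem_closedBall_zero_iff]
  have hconv : Convex ℝ K := by
    rw [hK]
    exact ((convex_closedBall (0 : E) _).translate_preimage_right e).is_linear_preimage
      (LinearMap.ker (x : E →ₗ[ℝ] ℝ)).subtype.isLinear
  have hbdd : Bornology.IsBounded K := by
    refine isBounded_iff_forall_norm_le.2 ⟨‖e + z‖ + 1, fun w hw => ?_⟩
    have h1 : ‖e + (w : E)‖ ≤ ‖e + z‖ := hw
    have h2 : ‖(w : E)‖ ≤ ‖e + (w : E)‖ + ‖e‖ := by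
      have := norm_sub_le (e + (w : E)) e
      rwa [add_sub_cancel_left] at this
    rw [Submodule.coe_norm]
    linarith
  have h0 : K ∈ 𝓝 (0 : LinearMap.ker (x : E →ₗ[ℝ] ℝ)) := by
    have hlt : ‖e + ((0 : LinearMap.ker (x : E →ₗ[ℝ] ℝ)) : E)‖ < ‖e + z‖ := by simpa [he] using hc
    filter_upwards [hcont.continuousAt.eventually (gt_mem_nhds hlt)] with w hw using le_of_lt hw
  have := neg_mem_of_invariant_projections hker (Metric.isCompact_of_isClosed_isBounded hclosed hbdd)
    hconv h0 (fun u hu => by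
      have hu0 : (u : E) ≠ 0 := by simpa using hu
      have hxu : x (u : E) = 0 := u.2
      obtain ⟨f, hf, hfc⟩ := hE u hu0
      have hfe := apply_exposed_eq_zero he hexp hxu hu0 (hfc e)
      refine ⟨f.comp (Submodule.subtypeL _), hf, fun y (hy : ‖e + (y : E)‖ ≤ ‖e + z‖) => ?_⟩
      have h3 := hfc (e + y)
      rw [map_add, hfe, zero_add, add_sub_assoc] at h3
      exact h3.trans hy) (y := ⟨z, hz⟩) (le_refl ‖e + z‖)
  simpa [K, ← sub_eq_add_neg] using this

/-- The reflection `y ↦ y - 2 (x y / x e) e` is isometric when `x` exposes `e`. It is stated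
without denominators, so that both sides depend continuously on `x` and `e`. -/
theorem norm_reflection_of_exposed [FiniteDimensional ℝ E]
    (hdim : Module.finrank ℝ E = 3) (hE : HasContractiveHyperplanes E)
    {x : StrongDual ℝ E} {e : E} (he : ‖e‖ = 1) (hxe : 0 < x e)
    (hexp : ∀ b, ‖b‖ ≤ 1 → x e ≤ x b → b = e) (y : E) :
    ‖x e • y - (2 * x y) • e‖ = x e * ‖y‖ := by
  have hsymm : ∀ z, x z = 0 → ‖e - z‖ = ‖e + z‖ := fun z hz => by
    refine le_antisymm (norm_sub_le_norm_add_of_exposed hdim hE he hxe hexp hz) ?_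
    have := norm_sub_le_norm_add_of_exposed hdim hE he hxe hexp (z := -z) (by simp [hz])
    rwa [sub_neg_eq_add, ← sub_eq_add_neg] at this
  have hxy : x e * ‖y‖ = ‖x e • y‖ := by rw [norm_smul, Real.norm_of_nonneg hxe.le]
  rw [hxy]
  rcases eq_or_ne (x y) 0 with h0 | h0
  · simp [h0]
  have h1 := hsymm ((x e / x y) • y - e) (by simp [h0])
  have e1 : x e • y = x y • (e + ((x e / x y) • y - e)) := by
    rw [add_sub_cancel, smul_smul, mul_div_cancel₀ _ h0]
  have e2 : x e • y - (2 * x y) • e = -(x y • (e - ((x e / x y) • y - e))) := by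
    rw [smul_sub, smul_sub, smul_smul, mul_div_cancel₀ _ h0]; module
  rw [e2, norm_neg, e1, norm_smul, norm_smul, h1]

theorem norm_eq_one_and_pos_of_exposed [Nontrivial E] {x : StrongDual ℝ E} {e : E}
    (he : ‖e‖ ≤ 1) (hexp : ∀ b, ‖b‖ ≤ 1 → x e ≤ x b → b = e) : ‖e‖ = 1 ∧ 0 < x e := by
  have he0 : e ≠ 0 := by
    rintro rfl
    obtain ⟨w, hw⟩ := exists_norm_eq E (zero_le_one' ℝ)
    have hw0 : w ≠ 0 := fun h0 => by simp [h0] at hw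
    rw [map_zero] at hexp
    rcases le_total 0 (x w) with h | h
    · exact hw0 (hexp w hw.le h)
    · exact hw0 (neg_eq_zero.1 (hexp (-w) (by rw [norm_neg, hw]) (by rw [map_neg]; linarith)))
  have hpos : 0 < x e := by
    by_contra! hle
    have := hexp (-e) (by rwa [norm_neg]) (by rw [map_neg]; linarith)
    have h2 : (2 : ℝ) • e = 0 := by
      rw [two_smul]
      nth_rewrite 1 [← this]
      exact neg_add_cancel e
    exact he0 ((smul_eq_zero.1 h2).resolve_left two_ne_zero)
  refine ⟨?_, hpos⟩
  have hn : 0 < ‖e‖ := norm_pos_iff.2 he0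
  have hun : ‖‖e‖⁻¹ • e‖ = 1 := by rw [norm_smul, norm_inv, norm_norm, inv_mul_cancel₀ hn.ne']
  have := hexp (‖e‖⁻¹ • e) hun.le (by
    rw [map_smul, smul_eq_mul]
    exact le_mul_of_one_le_left hpos.le ((one_le_inv₀ hn).2 he))
  rwa [this] at hun

/-- The isometric reflections exist for all unit functionals, by approximation: for an auxiliary
Euclidean norm `‖A b‖`, a maximizer `e` of `2 x(b) + ε ‖A b‖²` on the unit ball is exposed by
`x + ε ⟪A e, A ·⟫`, which tends to `x` as `ε` tends to `0`. -/
theorem exists_reflection_of_hasContractiveHyperplanes [FiniteDimensional ℝ E]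
    (hdim : Module.finrank ℝ E = 3) (hE : HasContractiveHyperplanes E)
    {x : StrongDual ℝ E} (hx : ‖x‖ = 1) :
    ∃ e : E, x e = 1 ∧ ∀ y, ‖y - (2 * x y) • e‖ = ‖y‖ := by
  have : Nontrivial E := Module.nontrivial_of_finrank_pos (R := ℝ) (by omega)
  let A : E ≃L[ℝ] EuclideanSpace ℝ (Fin (Module.finrank ℝ E)) := toEuclidean
  let ε : ℕ → ℝ := fun n => 1 / ((n : ℝ) + 1)
  have hε : ∀ n, 0 < ε n := fun n => by positivity
  have hε0 : Tendsto ε atTop (𝓝 0) := tendsto_one_div_add_atTop_nhds_zero_nat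
  have hex : ∀ n, ∃ e ∈ Metric.closedBall (0 : E) 1,
      ∀ b, ‖b‖ ≤ 1 → 2 * x b + ε n * ‖A b‖ ^ 2 ≤ 2 * x e + ε n * ‖A e‖ ^ 2 := fun n => by
    obtain ⟨e, he, hmax⟩ := (isCompact_closedBall (0 : E) 1).exists_isMaxOn ⟨0, by simp⟩
      (by fun_prop : Continuous fun b => 2 * x b + ε n * ‖A b‖ ^ 2).continuousOn
    exact ⟨e, he, fun b hb => hmax (mem_closedBall_zero_iff.2 hb)⟩
  choose e he hmax using hex
  have hle : ∀ n, ‖e n‖ ≤ 1 := fun n => mem_closedBall_zero_iff.1 (he n)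
  let X : ℕ → StrongDual ℝ E := fun n => x + ε n • (innerSL ℝ (A (e n))).comp (A : E →L[ℝ] _)
  have hX : ∀ n b, X n b = x b + ε n * inner ℝ (A (e n)) (A b) := fun n b => by simp [X]
  have hexp : ∀ n b, ‖b‖ ≤ 1 → X n (e n) ≤ X n b → b = e n := fun n b hb hle => by
    rw [hX, hX, real_inner_self_eq_norm_sq] at hle
    have h1 := hmax n b hb
    have h2 := norm_sub_sq_real (A (e n)) (A b)
    have h3 : ε n * ‖A (e n) - A b‖ ^ 2 ≤ 0 := by rw [h2]; linarith
    have h4 : ‖A (e n) - A b‖ ^ 2 ≤ 0 := nonpos_of_mul_nonpos_right h3 (hε n)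
    have h5 : A (e n) - A b = 0 := by
      rw [← norm_eq_zero]; exact pow_eq_zero_iff two_ne_zero |>.1 (le_antisymm h4 (sq_nonneg _))
    exact (A.injective (sub_eq_zero.1 h5)).symm
  have hunit := fun n => norm_eq_one_and_pos_of_exposed (hle n) (hexp n)
  have hrefl := fun n => norm_reflection_of_exposed hdim hE (hunit n).1 (hunit n).2 (hexp n)
  obtain ⟨e', he', φ, hφ, hlim⟩ := (isCompact_closedBall (0 : E) 1).tendsto_subseq he
  have hε' := hε0.comp hφ.tendsto_atTop
  have hAe : Tendsto (fun n => A (e (φ n))) atTop (𝓝 (A e')) := (A.continuous.tendsto _).comp hlim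
  have hxe : Tendsto (fun n => x (e (φ n))) atTop (𝓝 (x e')) := (x.continuous.tendsto _).comp hlim
  have hXy : ∀ y, Tendsto (fun n => X (φ n) y) atTop (𝓝 (x y)) := fun y => by
    simp only [hX]
    simpa using (hε'.mul (hAe.inner tendsto_const_nhds)).const_add (x y)
  have hXe : Tendsto (fun n => X (φ n) (e (φ n))) atTop (𝓝 (x e')) := by
    simp only [hX]
    simpa using hxe.add (hε'.mul (hAe.inner hAe))
  have hxb : ∀ b, ‖b‖ ≤ 1 → x b ≤ x e' := fun b hb => by
    have h1 : Tendsto (fun n => 2 * x b + ε (φ n) * ‖A b‖ ^ 2) atTop (𝓝 (2 * x b)) := by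
      simpa using (hε'.mul_const (‖A b‖ ^ 2)).const_add (2 * x b)
    have h2 : Tendsto (fun n => 2 * x (e (φ n)) + ε (φ n) * ‖A (e (φ n))‖ ^ 2) atTop
        (𝓝 (2 * x e')) := by
      simpa using (hxe.const_mul 2).add (hε'.mul (hAe.norm.pow 2))
    linarith [le_of_tendsto_of_tendsto' h1 h2 fun n => hmax (φ n) b hb]
  have hone : x e' = 1 := by
    refine le_antisymm ?_ ?_
    · have h1 := (le_abs_self _).trans (x.le_opNorm e')
      rw [hx, one_mul] at h1
      exact h1.trans (mem_closedBall_zero_iff.1 he')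
    · rw [← hx]
      refine ContinuousLinearMap.opNorm_le_of_unit_norm ?_ fun z hz => ?_
      · simpa using hxb 0 (by simp)
      · refine abs_le.2 ⟨?_, hxb z hz.le⟩
        have := hxb (-z) (by rw [norm_neg, hz])
        rw [map_neg] at this
        linarith
  refine ⟨e', hone, fun y => ?_⟩
  have h1 : Tendsto (fun n => ‖X (φ n) (e (φ n)) • y - (2 * X (φ n) y) • e (φ n)‖) atTop
      (𝓝 ‖x e' • y - (2 * x y) • e'‖) :=
    ((hXe.smul_const y).sub (((hXy y).const_mul 2).smul hlim)).norm
  have h2 : Tendsto (fun n => X (φ n) (e (φ n)) * ‖y‖) atTop (𝓝 (x e' * ‖y‖)) := hXe.mul_const _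
  have := tendsto_nhds_unique h1 (h2.congr fun n => (hrefl (φ n) y).symm)
  simpa [hone] using this

end Exposed

/-! ### Spaces in which every unit vector is reversed by an isometric reflection -/

section Reflections
variable {D : Type*} [NormedAddCommGroup D] [NormedSpace ℝ D]

/-- `g x = 1` and the linear reflection `y ↦ y - 2 g(y) x`, which maps `x` to `-x` and fixes
`ker g` pointwise, preserves the norm. -/
def IsNormReflection (x : D) (g : StrongDual ℝ D) : Prop :=
  g x = 1 ∧ ∀ y, ‖y - (2 * g y) • x‖ = ‖y‖

theorem IsNormReflection.neg {x : D} {g : StrongDual ℝ D} (h : IsNormReflection x g) :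
    IsNormReflection (-x) (-g) := by
  refine ⟨by simpa using h.1, fun y => ?_⟩
  simpa using h.2 y

/-- The reflections attached to `g` and `g'` compose to the shear `y ↦ y + 2 (g' - g)(y) x`, whose
powers are all isometric only if `g' = g`. -/
theorem IsNormReflection.unique {x : D} {g g' : StrongDual ℝ D} (h : IsNormReflection x g)
    (h' : IsNormReflection x g') : g = g' := by
  have hx : x ≠ 0 := fun h0 => by simpa [h0] using h.1
  ext y
  have hpow : ∀ n : ℕ, ∀ z, ‖z + (n * (2 * (g' z - g z))) • x‖ = ‖z‖ := by
    intro n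
    induction n with
    | zero => simp
    | succ n ih =>
      intro z
      have h1 := h.2 (z - (2 * g' z) • x)
      rw [h'.2 z] at h1
      have h2 := ih (z - (2 * g' z) • x - (2 * g (z - (2 * g' z) • x)) • x)
      rw [h1] at h2
      rw [← h2]
      congr 1
      simp only [map_sub, map_smul, h.1, h'.1, smul_eq_mul]
      push_cast
      module
  by_contra hne
  have hpos : 0 < |2 * (g' y - g y)| * ‖x‖ :=
    mul_pos (abs_pos.2 (mul_ne_zero two_ne_zero (sub_ne_zero.2 (Ne.symm hne)))) (norm_pos_iff.2 hx)
  obtain ⟨n, hn⟩ := exists_nat_gt (2 * ‖y‖ / (|2 * (g' y - g y)| * ‖x‖))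
  rw [div_lt_iff₀ hpos] at hn
  have h1 : ‖((n : ℝ) * (2 * (g' y - g y))) • x‖ ≤ ‖y‖ + ‖y‖ := by
    have := norm_sub_le (y + ((n : ℝ) * (2 * (g' y - g y))) • x) y
    rwa [add_sub_cancel_left, hpow n y] at this
  rw [norm_smul, Real.norm_eq_abs, abs_mul, Nat.abs_cast] at h1
  linarith

theorem IsNormReflection.norm_le_one {x : D} {g : StrongDual ℝ D} (hx : ‖x‖ = 1)
    (h : IsNormReflection x g) : ‖g‖ ≤ 1 := by
  refine g.opNorm_le_bound zero_le_one fun y => ?_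
  have h1 := norm_sub_le y (y - (2 * g y) • x)
  rw [sub_sub_cancel, h.2, norm_smul, hx, mul_one, Real.norm_eq_abs, abs_mul, abs_two] at h1
  rw [Real.norm_eq_abs]
  linarith

/-- Conjugating a reflection by another one, acting on `v` as `s v = v - 2 g(v) x`. -/
theorem IsNormReflection.conj {x v : D} {g f : StrongDual ℝ D} (h : IsNormReflection x g)
    (hf : IsNormReflection v f) :
    IsNormReflection (v - (2 * g v) • x) (f - (2 * f x) • g) := by
  have hcomp : ∀ y, (f - (2 * f x) • g) y = f (y - (2 * g y) • x) := fun y => by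
    simp; ring
  have hinv : ∀ y, y - (2 * g y) • x - (2 * g (y - (2 * g y) • x)) • x = y := fun y => by
    simp only [map_sub, map_smul, h.1, smul_eq_mul]; module
  refine ⟨by rw [hcomp, hinv, hf.1], fun y => ?_⟩
  rw [hcomp, ← h.2 y, ← hf.2 (y - (2 * g y) • x),
    ← h.2 (y - (2 * g y) • x - (2 * f (y - (2 * g y) • x)) • v)]
  congr 1
  simp only [map_sub, map_smul, h.1, smul_eq_mul]
  module

/-- The functional of the isometric reflection depends continuously on the unit vector: it is unique,
it lies in a compact ball, and the defining relation is closed. -/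
theorem continuousOn_of_isNormReflection [FiniteDimensional ℝ D] {g : D → StrongDual ℝ D}
    (hg : ∀ x, ‖x‖ = 1 → IsNormReflection x (g x)) :
    ContinuousOn g (Metric.sphere 0 1) := by
  intro x hx
  refine (isCompact_closedBall (0 : StrongDual ℝ D) 1).tendsto_nhds_of_unique_mapClusterPt ?_ ?_
  · filter_upwards [self_mem_nhdsWithin] with y hy
    have hy : ‖y‖ = 1 := mem_sphere_zero_iff_norm.1 hy
    exact mem_closedBall_zero_iff.2 ((hg y hy).norm_le_one hy)
  · intro f _ hf
    obtain ⟨U, hU, hlim⟩ := mapClusterPt_iff_ultrafilter.1 hf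
    have hid : Tendsto (fun y : D => y) U (𝓝 x) := hU.trans nhdsWithin_le_nhds
    have hmem : ∀ᶠ y in (U : Filter D), IsNormReflection y (g y) := by
      filter_upwards [hU self_mem_nhdsWithin] with y hy using hg y (mem_sphere_zero_iff_norm.1 hy)
    have happ : ∀ z, Tendsto (fun y => g y z) U (𝓝 (f z)) := fun z =>
      ((ContinuousLinearMap.apply ℝ ℝ z).continuous.tendsto f).comp hlim
    have hev : Tendsto (fun y => g y y) U (𝓝 (f x)) :=
      (isBoundedBilinearMap_apply.continuous.tendsto (f, x)).comp (hlim.prodMk_nhds hid)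
    refine IsNormReflection.unique ⟨?_, fun z => ?_⟩ (hg x (mem_sphere_zero_iff_norm.1 hx))
    · exact tendsto_nhds_unique hev
        (tendsto_const_nhds.congr' (hmem.mono fun y hy => hy.1.symm))
    · exact tendsto_nhds_unique
        ((tendsto_const_nhds.sub (((happ z).const_mul 2).smul hid)).norm)
        (tendsto_const_nhds.congr' (hmem.mono fun y hy => (hy.2 z).symm))

/-- Isometric reflections exchange any two independent unit vectors up to sign. On the plane spanned
by `x` and `y`, with `a` the `x`-coordinate, the reflected vector `x - 2 g v(x) v` is a multiple of
`y` when `g v(x) a(v) = 1 / 2`, and this product runs from `1` to `0` as `v` moves from `x` into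
`ker (g x)`. -/
theorem exists_reflection_eq_or_eq_neg [FiniteDimensional ℝ D] {g : D → StrongDual ℝ D}
    (hg : ∀ x, ‖x‖ = 1 → IsNormReflection x (g x)) {x y : D} (hx : ‖x‖ = 1) (hy : ‖y‖ = 1)
    (hxy : LinearIndependent ℝ ![x, y]) :
    ∃ v, ‖v‖ = 1 ∧ (x - (2 * g v x) • v = y ∨ x - (2 * g v x) • v = -y) := by
  have hpair := LinearIndependent.pair_iff.1 hxy
  -- `a` is the `x`-coordinate on the plane spanned by `x` and `y`.
  obtain ⟨a, hax, hay⟩ : ∃ a : StrongDual ℝ D, a x = 1 ∧ a y = 0 := by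
    have : x ∉ Submodule.span ℝ {y} := fun hmem => by
      obtain ⟨c, hc⟩ := Submodule.mem_span_singleton.1 hmem
      have := hpair 1 (-c) (by rw [← hc]; module)
      exact one_ne_zero this.1
    obtain ⟨f, hf, hfy⟩ := Submodule.exists_le_ker_of_notMem this
    have hfy : f y = 0 := hfy (Submodule.mem_span_singleton_self y)
    refine ⟨LinearMap.toContinuousLinearMap ((f x)⁻¹ • f), ?_, ?_⟩
    · simp [hf]
    · simp [hfy]
  set w₀ := y - g x y • x with hw₀
  let p : ℝ → D := fun t => (1 - t) • x + t • w₀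
  have hp0 : ∀ t, p t ≠ 0 := fun t h0 => by
    have e : p t = (1 - t - t * g x y) • x + t • y := by simp only [p, hw₀]; module
    have := hpair _ _ (e ▸ h0)
    obtain ⟨h1, h2⟩ := this
    rw [h2] at h1
    simp at h1
  let v : ℝ → D := fun t => ‖p t‖⁻¹ • p t
  have hv : ∀ t, ‖v t‖ = 1 := fun t => by
    simp only [v]
    rw [norm_smul, norm_inv, norm_norm, inv_mul_cancel₀ (norm_ne_zero_iff.2 (hp0 t))]
  have hvc : Continuous v := by
    have : Continuous p := by fun_prop
    exact (this.norm.inv₀ fun t => norm_ne_zero_iff.2 (hp0 t)).smul this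
  have hgc : Continuous fun t => g (v t) :=
    (continuousOn_of_isNormReflection hg).comp_continuous hvc fun t =>
      mem_sphere_zero_iff_norm.2 (hv t)
  have hφc : Continuous fun t => g (v t) x * a (v t) :=
    ((ContinuousLinearMap.apply ℝ ℝ x).continuous.comp hgc).mul (a.continuous.comp hvc)
  have hv0 : v 0 = x := by simp [v, p, hx]
  have hφ0 : g (v 0) x * a (v 0) = 1 := by rw [hv0, (hg x hx).1, hax, one_mul]
  -- The reflection at `x` fixes `v 1 ∈ ker (g x)`, so by equivariance `g (v 1)` is invariant under
  -- it and vanishes at `x`.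
  have hφ1 : g (v 1) x * a (v 1) = 0 := by
    have hgv : g x (v 1) = 0 := by simp [v, p, hw₀, (hg x hx).1]
    have h1 := (hg x hx).conj (hg _ (hv 1))
    rw [hgv, mul_zero, zero_smul, sub_zero] at h1
    have h2 := congrArg (fun f : StrongDual ℝ D => f x) (h1.unique (hg _ (hv 1)))
    simp [(hg x hx).1] at h2
    rw [show g (v 1) x = 0 by linarith, zero_mul]
  obtain ⟨t, _, ht⟩ := intermediate_value_Icc' (zero_le_one' ℝ) hφc.continuousOn
    (show (1 / 2 : ℝ) ∈ Set.Icc _ _ by rw [hφ0, hφ1]; norm_num)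
  have ht : g (v t) x * a (v t) = 1 / 2 := ht
  refine ⟨v t, hv t, ?_⟩
  obtain ⟨α, β, hαβ⟩ : ∃ α β : ℝ, x - (2 * g (v t) x) • v t = α • x + β • y := by
    refine ⟨1 - 2 * g (v t) x * (‖p t‖⁻¹ * (1 - t - t * g x y)),
      -(2 * g (v t) x * (‖p t‖⁻¹ * t)), ?_⟩
    simp only [v, p, hw₀]
    module
  have hα : α = 0 := by
    have := congrArg a hαβ
    simp only [map_sub, map_add, map_smul, smul_eq_mul, hax, hay] at this
    linarith
  have hβ : |β| = 1 := by
    have := (hg _ (hv t)).2 x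
    rw [hαβ, hα, zero_smul, zero_add, norm_smul, hx, hy, mul_one] at this
    exact this
  rw [hαβ, hα, zero_smul, zero_add]
  rcases eq_or_eq_neg_of_abs_eq hβ with h | h
  · left; rw [h, one_smul]
  · right; rw [h, neg_one_smul]

/-- If a reflection maps `x` to `z`, it maps `g x` to `g z` and `z` to `x`, so `g z x = g x z`. -/
theorem isNormReflection_symm [FiniteDimensional ℝ D] {g : D → StrongDual ℝ D}
    (hg : ∀ x, ‖x‖ = 1 → IsNormReflection x (g x)) {x y : D} (hx : ‖x‖ = 1) (hy : ‖y‖ = 1) :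
    g x y = g y x := by
  have hneg : ∀ z, ‖z‖ = 1 → g (-z) = -g z := fun z hz =>
    (hg (-z) (by rwa [norm_neg])).unique (hg z hz).neg
  by_cases hxy : LinearIndependent ℝ ![x, y]
  · obtain ⟨v, hv, hvy⟩ := exists_reflection_eq_or_eq_neg hg hx hy hxy
    obtain ⟨z, hz⟩ : ∃ z, z = x - (2 * g v x) • v := ⟨_, rfl⟩
    have hz1 : ‖z‖ = 1 := by rw [hz, (hg v hv).2, hx]
    have hgz : g z = g x - (2 * g x v) • g v := by
      have := (hg v hv).conj (hg x hx)
      rw [← hz] at this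
      exact (hg z hz1).unique this
    have hsz : g x z = g z x := by
      rw [hgz, hz]; simp; ring
    rw [← hz] at hvy
    rcases hvy with h | h
    · rwa [h] at hsz
    · rw [h, hneg y hy] at hsz
      simpa using hsz
  · rw [LinearIndependent.pair_iff' (fun h0 => by simp [h0] at hx)] at hxy
    push Not at hxy
    obtain ⟨c, hc⟩ := hxy
    have habs : |c| = 1 := by
      rw [← hc, norm_smul, hx, mul_one] at hy
      exact hy
    rcases eq_or_eq_neg_of_abs_eq habs with h | h
    · rw [← hc, h, one_smul]
    · rw [← hc, h, neg_one_smul, hneg x hx]; simp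

theorem parallelogram_of_isNormReflection [FiniteDimensional ℝ D]
    (hD : ∀ x : D, ‖x‖ = 1 → ∃ g, IsNormReflection x g) (x y : D) :
    ‖x + y‖ * ‖x + y‖ + ‖x - y‖ * ‖x - y‖ = 2 * (‖x‖ * ‖x‖ + ‖y‖ * ‖y‖) := by
  choose! g hg using hD
  -- The bilinear form extending `g`; at `x = 0` the factor `‖x‖` makes it vanish.
  let B : D → D → ℝ := fun x y => ‖x‖ * g (‖x‖⁻¹ • x) y
  have hunit : ∀ z : D, z ≠ 0 → ‖‖z‖⁻¹ • z‖ = 1 := fun z hz => by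
    rw [norm_smul, norm_inv, norm_norm, inv_mul_cancel₀ (norm_ne_zero_iff.2 hz)]
  have hsm : ∀ z : D, ‖z‖ • (‖z‖⁻¹ • z) = z := fun z => by
    rcases eq_or_ne z 0 with rfl | hz
    · simp
    · rw [smul_smul, mul_inv_cancel₀ (norm_ne_zero_iff.2 hz), one_smul]
  have hself : ∀ z, B z z = ‖z‖ * ‖z‖ := fun z => by
    rcases eq_or_ne z 0 with rfl | hz
    · simp [B]
    · have h1 : g (‖z‖⁻¹ • z) z = ‖z‖ := by
        have h2 := congrArg (g (‖z‖⁻¹ • z)) (hsm z)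
        rwa [map_smul, (hg _ (hunit z hz)).1, smul_eq_mul, mul_one, eq_comm] at h2
      simp only [B, h1]
  have hsymm : ∀ z w, B z w = B w z := fun z w => by
    rcases eq_or_ne z 0 with rfl | hz
    · simp [B]
    rcases eq_or_ne w 0 with rfl | hw
    · simp [B]
    have h1 : g (‖z‖⁻¹ • z) w = ‖w‖ * g (‖z‖⁻¹ • z) (‖w‖⁻¹ • w) := by
      rw [← smul_eq_mul, ← map_smul, hsm]
    have h2 : g (‖w‖⁻¹ • w) z = ‖z‖ * g (‖w‖⁻¹ • w) (‖z‖⁻¹ • z) := by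
      rw [← smul_eq_mul, ← map_smul, hsm]
    simp only [B]
    rw [h1, h2, isNormReflection_symm hg (hunit z hz) (hunit w hw)]
    ring
  have hadd : ∀ z w w', B z (w + w') = B z w + B z w' := fun z w w' => by simp [B, mul_add]
  have hsub : ∀ z w w', B z (w - w') = B z w - B z w' := fun z w w' => by simp [B, mul_sub]
  rw [← hself, ← hself, ← hself, ← hself, hadd, hsub, hsymm (x + y), hsymm (x + y), hsymm (x - y),
    hsymm (x - y), hadd, hadd, hsub, hsub, hsymm y x]
  ring

end Reflections

/-! ### The parallelogram law -/

section Assembly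
variable {E : Type*} [NormedAddCommGroup E] [NormedSpace ℝ E]

/-- A normed space embeds isometrically into its bidual, and the dual of a Hilbert space is
a Hilbert space. -/
theorem parallelogram_of_dual
    (hD : ∀ x y : StrongDual ℝ E,
      ‖x + y‖ * ‖x + y‖ + ‖x - y‖ * ‖x - y‖ = 2 * (‖x‖ * ‖x‖ + ‖y‖ * ‖y‖)) (x y : E) :
    ‖x + y‖ * ‖x + y‖ + ‖x - y‖ * ‖x - y‖ = 2 * (‖x‖ * ‖x‖ + ‖y‖ * ‖y‖) := by
  let := InnerProductSpace.ofNorm (𝕜 := ℝ) hD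
  let J := NormedSpace.inclusionInDoubleDualLi (E := E) ℝ
  let R := InnerProductSpace.toDual ℝ (StrongDual ℝ E)
  have h := parallelogram_law_with_norm_mul ℝ (R.symm (J x)) (R.symm (J y))
  rw [← map_add, ← map_sub, ← J.map_add, ← J.map_sub] at h
  simpa only [LinearIsometryEquiv.norm_map, LinearIsometry.norm_map] using h

/-- The dual space satisfies `IsNormReflection` at every unit functional `φ`, by taking adjoints of the
isometric reflections of `E`. -/
theorem parallelogram_of_finrank_eq_three (hdim : Module.finrank ℝ E = 3)
    (hE : HasContractiveHyperplanes E) (x y : E) :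
    ‖x + y‖ * ‖x + y‖ + ‖x - y‖ * ‖x - y‖ = 2 * (‖x‖ * ‖x‖ + ‖y‖ * ‖y‖) := by
  have : FiniteDimensional ℝ E := Module.finite_of_finrank_pos (by omega)
  refine parallelogram_of_dual (parallelogram_of_isNormReflection fun φ hφ => ?_) x y
  obtain ⟨e, he, hr⟩ := exists_reflection_of_hasContractiveHyperplanes hdim hE hφ
  refine ⟨NormedSpace.inclusionInDoubleDual ℝ E e, he, ?_⟩
  have hle : ∀ ξ : StrongDual ℝ E, ‖ξ - (2 * ξ e) • φ‖ ≤ ‖ξ‖ := fun ξ => by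
    refine ContinuousLinearMap.opNorm_le_bound _ (norm_nonneg _) fun z => ?_
    have h1 : (ξ - (2 * ξ e) • φ) z = ξ (z - (2 * φ z) • e) := by simp; ring
    rw [h1, ← hr z]
    exact ξ.le_opNorm _
  intro ξ
  rw [NormedSpace.dual_def]
  refine le_antisymm (hle ξ) ?_
  have h2 := hle (ξ - (2 * ξ e) • φ)
  have h3 : ξ - (2 * ξ e) • φ - (2 * (ξ - (2 * ξ e) • φ) e) • φ = ξ := by
    have : (ξ - (2 * ξ e) • φ) e = -ξ e := by simp [he]; ring
    rw [this]; module
  rwa [h3] at h2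

theorem exists_finrank_eq_three_of_mem (hdim : 3 ≤ Module.rank ℝ E) {x y : E}
    (hxy : LinearIndependent ℝ ![x, y]) :
    ∃ Y : Submodule ℝ E, Module.finrank ℝ Y = 3 ∧ x ∈ Y ∧ y ∈ Y := by
  obtain ⟨z, hz⟩ := exists_linearIndependent_snoc_of_lt_rank hxy
    (lt_of_lt_of_le (by norm_cast) hdim)
  refine ⟨Submodule.span ℝ (Set.range (Fin.snoc ![x, y] z : Fin 3 → E)), ?_, ?_, ?_⟩
  · rw [finrank_span_eq_card hz, Fintype.card_fin]
  · exact Submodule.subset_span ⟨0, rfl⟩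
  · exact Submodule.subset_span ⟨1, rfl⟩

theorem parallelogram_of_three_le_rank (hdim : 3 ≤ Module.rank ℝ E)
    (hE : HasContractiveHyperplanes E) (x y : E) :
    ‖x + y‖ * ‖x + y‖ + ‖x - y‖ * ‖x - y‖ = 2 * (‖x‖ * ‖x‖ + ‖y‖ * ‖y‖) := by
  rcases eq_or_ne x 0 with rfl | hx
  · simp; ring
  by_cases hxy : LinearIndependent ℝ ![x, y]
  · obtain ⟨Y, hY, hxY, hyY⟩ := exists_finrank_eq_three_of_mem hdim hxy
    exact parallelogram_of_finrank_eq_three hY (hE.submodule Y) ⟨x, hxY⟩ ⟨y, hyY⟩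
  · rw [LinearIndependent.pair_iff' hx] at hxy
    push Not at hxy
    obtain ⟨c, rfl⟩ := hxy
    have h1 : x + c • x = (1 + c) • x := by module
    have h2 : x - c • x = (1 - c) • x := by module
    simp only [h1, h2, norm_smul, Real.norm_eq_abs]
    linear_combination ‖x‖ ^ 2 * (abs_mul_abs_self (1 + c) + abs_mul_abs_self (1 - c)
      - 2 * abs_mul_abs_self c)

end Assembly

theorem mainTheorem2 {X : Type u} [NormedAddCommGroup X] [NormedSpace ℝ X] [CompleteSpace X]
    (hdim : 3 ≤ Module.rank ℝ X) (hF : flinnElements X = Set.univ) :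
    ∃ (H : Type u) (_ : NormedAddCommGroup H) (_ : InnerProductSpace ℝ H) (_ : CompleteSpace H),
      Nonempty (X ≃ₗᵢ[ℝ] H) :=
  ⟨X, inferInstance, InnerProductSpace.ofNorm (𝕜 := ℝ) (parallelogram_of_three_le_rank hdim
    (hasContractiveHyperplanes_of_flinnElements_eq_univ hF)), inferInstance,
    ⟨LinearIsometryEquiv.refl ℝ X⟩⟩
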